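/- **Setting.** Let $V_0=\{\emptyset\}$ and $V_{n+1}=\mathcal P(V_n)$ (the hereditarily finite sets of rank $\le n$, resp. $\le n+1$), and let $\tau_n:V_{n+1}\to V_n$ be given by $\tau_0(a)=\emptyset$, $\tau_{n+1}(a)=\{\tau_n(x): x\in a\}$. A *set* (of the theory AS, approximations of sets) is a sequence $A=(F(0,A),F(1,A),F(2,A),\dots)$ with $F(n,A)\in V_n$ and $\tau_n(F(n+1,A))=F(n,A)$ for all $n$; every such sequence is a set. Membership is defined by: $x\in A$ iff $F(n,x)\in F(n+1,A)$ for all $n$. $U$ is the collection of all sets. All objects below are sets in this sense. For every property $P$ of sets there is a smallest set (with respect to $\subseteq$) containing all $x$ with $P(x)$; it is the set with $F(n+1,\cdot)=\{F(n,x): P(x)\}$. Pairs $\{a,b\}$, ordered pairs $(a,b)=\{\{a\},\{a,b\}\}$, subsets and the power set $\mathcal P(A)$ are defined as usual. A function $f:A\to B$ is a set of ordered pairs $(a,b)$ with $a\in A$, $b\in B$ that is total on $A$ and single-valued; injections and bijections are as usual. $A\le_c B$ means that there is an injection from $A$ into $B$; $A=_cB$ means $A\le_cB$ and $B\le_cA$;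 $A<_cB$ means $A\le_c B$ but not $A=_cB$. A set is infinite if it is in bijection with a proper subset of itself. $0=\emptyset$, $n+1=n\cup\{n\}$, and $\omega$ is the smallest set containing all these finite ordinals. A set $A$ is *well-orderable* if there is a set $R$ of ordered pairs of elements of $A$ such that, writing $x<y$ for "$x\ne y$ and $(x,y)\in R$", (a) $<$ is a strict linear order of $A$; (b) every nonempty set $S\subseteq A$ has a $<$-least element; (c) for every $x\in A$ there is an $n$ such that no $y\in A$ with $F(n,y)=F(n,x)$ satisfies $x<y$. An *indexed system* $I=\{(j,A_j): j\in J\}$ is a function from a set $J$ to a set $\mathcal F$. A *choice function* on $I$ is a function $f$ with domain $J$ such that $f(j)\in A_j$ for all $j\in J$. The *product* $\prod_{j\in J}A_j$ is the smallest set containing all choice functions on $I$, and $A^B$ is the smallest set containing all functions $f:B\to A$. **Theorem 10.9.** 1. Let $I=\{(j,A_j): j\in J\}$ be an indexed system of sets with $A_j\neq\emptyset$ for all $j\in J$. Then $\prod_{j\in J}A_j$ is well-orderable if and only if $1<_c A_j$ holds for only finitely many indices $j\in J$ and $A_j$ is well-orderable for every $j\in J$. 2. If $A_j=\emptyset$ for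 some $j\in J$, then $\prod_{j\in J}A_j=\emptyset$, which is well-orderable. 3. If $B$ is infinite and $2\le_c A$, then $A^B=_c\mathcal P(\omega)$. -/

import Mathlib

namespace AS

/-- `Approx n` is the collection of hereditarily finite sets of rank at most `n`: the empty set is
the only one of rank `0`, and a hereditarily finite set has rank at most `n + 1` exactly when all
its elements have rank at most `n`. (Each `Approx n` is finite, so all its subsets are finite.) -/
def Approx : ℕ → Type
  | 0 => Unit
  | n + 1 => Set (Approx n)

/-- The `n`-th approximation `F(n, a)` of a hereditarily finite set `a` of rank at most `n + 1`,
given by `F(0, a) = {}` and `F(n + 1, a) = {F(n, x) | x ∈ a}`. -/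
def trunc : (n : ℕ) → Approx (n + 1) → Approx n
  | 0, _ => ()
  | n + 1, a => (Set.image (trunc n) a : Set (Approx n))

end AS

/-- The universe of the theory of approximations of sets: a set is (given by) a path in the
universal tree, that is, a sequence of hereditarily finite sets `F(0, A), F(1, A), F(2, A), …`
with `F(n, A)` of rank at most `n` and `F(n, F(n + 1, A)) = F(n, A)`. Every path is a set. -/
@[ext]
structure ASet where
  /-- `A.F n` is the `n`-th approximation `F(n, A)` of the set `A`. -/
  F : (n : ℕ) → AS.Approx n
  coherent : ∀ n, AS.trunc n (F (n + 1)) = F n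

namespace AS

/-- The elements of the `(n + 1)`-th approximation of `A`. -/
def level (A : ASet) (n : ℕ) : Set (Approx n) := A.F (n + 1)

/-- `x ∈ A` means that `F(n, x) ∈ F(n + 1, A)` for every `n`. -/
instance : Membership ASet ASet where
  mem A x := ∀ n, x.F n ∈ level A n

/-- `B ⊆ A` means that every element of `B` is an element of `A`. -/
instance : HasSubset ASet where
  Subset B A := ∀ x : ASet, x ∈ B → x ∈ A

theorem mem_iff {x A : ASet} : x ∈ A ↔ ∀ n, x.F n ∈ level A n := Iff.rfl

theorem subset_iff {B A : ASet} : B ⊆ A ↔ ∀ x : ASet, x ∈ B → x ∈ A := Iff.rfl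

theorem image_level (A : ASet) (n : ℕ) : trunc n '' level A (n + 1) = level A n :=
  A.coherent (n + 1)

/-- The smallest set containing all `x` with `P x`; it is determined by
`F(n + 1, hull P) = {F(n, x) | P x}`. -/
def hull (P : ASet → Prop) : ASet where
  F n := match n with
    | 0 => ()
    | n + 1 => ({a | ∃ x : ASet, P x ∧ x.F n = a} : Set (Approx n))
  coherent n := by
    cases n with
    | zero => rfl
    | succ n =>
      change trunc n '' {a | ∃ x : ASet, P x ∧ x.F (n + 1) = a} =
        {a | ∃ x : ASet, P x ∧ x.F n = a}
      ext a
      constructor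
      · rintro ⟨_, ⟨x, hx, rfl⟩, rfl⟩
        exact ⟨x, hx, (x.coherent n).symm⟩
      · rintro ⟨x, hx, rfl⟩
        exact ⟨_, ⟨x, hx, rfl⟩, x.coherent n⟩

theorem mem_hull_iff {P : ASet → Prop} {x : ASet} :
    x ∈ hull P ↔ ∀ n, ∃ y : ASet, P y ∧ y.F n = x.F n := Iff.rfl

theorem subset_hull {P : ASet → Prop} {x : ASet} (hx : P x) : x ∈ hull P :=
  fun _ => ⟨x, hx, rfl⟩

theorem hull_subset {P : ASet → Prop} {A : ASet} (h : ∀ x, P x → x ∈ A) : hull P ⊆ A := by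
  intro x hx n
  obtain ⟨y, hy, e⟩ := hx n
  rw [← e]
  exact h y hy n

theorem F_eq_of_le {x y : ASet} {m n : ℕ} (hmn : m ≤ n) (h : x.F n = y.F n) : x.F m = y.F m := by
  induction n, hmn using Nat.le_induction with
  | base => exact h
  | succ k _ ih => exact ih (by rw [← x.coherent, ← y.coherent, h])

/-- Every element of `F(n + 1, A)` is of the form `F(n, x)` with `x ∈ A`. -/
theorem exists_mem_of_level {A : ASet} {n : ℕ} {a : Approx n} (ha : a ∈ level A n) :
    ∃ x : ASet, x ∈ A ∧ x.F n = a := by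
  have step : ∀ k (b : Approx k), ∃ c : Approx (k + 1),
      b ∈ level A k → c ∈ level A (k + 1) ∧ trunc k c = b := by
    intro k b
    by_cases hb : b ∈ level A k
    · obtain ⟨c, hc⟩ := (image_level A k).symm ▸ hb
      exact ⟨c, fun _ => hc⟩
    · exact ⟨A.F (k + 1), fun h => absurd h hb⟩
  choose up hup using step
  -- the ancestors of `a`
  have key : ∀ (k : ℕ) (b : Approx k), b ∈ level A k → ∃ f : (i : ℕ) → Approx i,
      (∀ i < k, trunc i (f (i + 1)) = f i) ∧ f k = b ∧ ∀ i ≤ k, f i ∈ level A i := by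
    intro k
    induction k with
    | zero =>
      intro b hb
      refine ⟨fun i => A.F i, by simp, rfl, ?_⟩
      rintro i hi
      obtain rfl : i = 0 := by omega
      exact hb
    | succ k ih =>
      intro b hb
      have hb' : trunc k b ∈ level A k := by
        rw [← image_level A k]; exact ⟨b, hb, rfl⟩
      obtain ⟨f, h1, h2, h3⟩ := ih _ hb'
      refine ⟨Function.update f (k + 1) b, ?_, by simp, ?_⟩
      · intro i hi
        rcases Nat.lt_succ_iff_lt_or_eq.mp hi with h | h
        · rw [Function.update_of_ne (by omega), Function.update_of_ne (by omega)]
          exact h1 i h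
        · subst h
          rw [Function.update_self, Function.update_of_ne (by omega), h2]
      · intro i hi
        rcases Nat.le_succ_iff.mp hi with h | h
        · rw [Function.update_of_ne (by omega)]
          exact h3 i h
        · subst h
          rw [Function.update_self]
          exact hb
  obtain ⟨f, h1, h2, h3⟩ := key n a ha
  -- continue the path of the ancestors of `a` beyond level `n`
  let s : (i : ℕ) → Approx i := fun i =>
    Nat.rec (motive := Approx) (f 0)
      (fun i b => if i + 1 ≤ n then f (i + 1) else up i b) i
  have hsf : ∀ i ≤ n, s i = f i := by
    intro i hi
    cases i with
    | zero => rfl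
    | succ i => exact if_pos hi
  have hsu : ∀ i, ¬ i + 1 ≤ n → s (i + 1) = up i (s i) := fun i hi => if_neg hi
  have hs : ∀ i, s i ∈ level A i := by
    intro i
    induction i with
    | zero => exact h3 0 (Nat.zero_le n)
    | succ i ih =>
      by_cases hi : i + 1 ≤ n
      · rw [hsf _ hi]; exact h3 _ hi
      · rw [hsu _ hi]; exact (hup i _ ih).1
  refine ⟨⟨s, fun i => ?_⟩, hs, (hsf n le_rfl).trans h2⟩
  by_cases hi : i + 1 ≤ n
  · rw [hsf _ hi, hsf i (by omega)]; exact h1 i hi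
  · rw [hsu _ hi]; exact (hup i _ (hs i)).2

/-- Extensionality. -/
theorem ext_mem {A B : ASet} (h : ∀ x : ASet, x ∈ A ↔ x ∈ B) : A = B := by
  ext n
  cases n with
  | zero => rfl
  | succ n =>
    change level A n = level B n
    ext a
    constructor
    · intro ha
      obtain ⟨x, hx, rfl⟩ := exists_mem_of_level ha
      exact (h x).1 hx n
    · intro ha
      obtain ⟨x, hx, rfl⟩ := exists_mem_of_level ha
      exact (h x).2 hx n

/-- The empty set. -/
def empty : ASet := hull fun _ => False

theorem not_mem_empty (x : ASet) : x ∉ empty := fun h => (h 0).elim fun _ hy => hy.1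

/-- The pair `{a, b}`. -/
def pair (a b : ASet) : ASet := hull fun x => x = a ∨ x = b

theorem mem_pair {a b x : ASet} : x ∈ pair a b ↔ x = a ∨ x = b := by
  refine ⟨fun h => ?_, fun h => subset_hull h⟩
  by_contra hne
  push Not at hne
  obtain ⟨ha, hb⟩ := hne
  obtain ⟨m, hm⟩ : ∃ m, x.F m ≠ a.F m := by
    by_contra hc; push Not at hc; exact ha (ASet.ext (funext hc))
  obtain ⟨k, hk⟩ : ∃ k, x.F k ≠ b.F k := by
    by_contra hc; push Not at hc; exact hb (ASet.ext (funext hc))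
  obtain ⟨y, rfl | rfl, hy⟩ := h (max m k)
  · exact hm (F_eq_of_le (le_max_left m k) hy.symm)
  · exact hk (F_eq_of_le (le_max_right m k) hy.symm)

/-- The singleton `{a}`. -/
def single (a : ASet) : ASet := pair a a

/-- The ordered pair `(a, b) = {{a}, {a, b}}`. -/
def opair (a b : ASet) : ASet := pair (single a) (pair a b)

theorem opair_inj {a b c d : ASet} : opair a b = opair c d ↔ a = c ∧ b = d := by
  refine ⟨fun h => ?_, by rintro ⟨rfl, rfl⟩; rfl⟩
  have hp : ∀ {u v u' v' : ASet}, pair u v = pair u' v' →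
      (u = u' ∨ u = v') ∧ (v = u' ∨ v = v') ∧ (u' = u ∨ u' = v) ∧ (v' = u ∨ v' = v) := by
    intro u v u' v' e
    exact ⟨mem_pair.1 (e ▸ mem_pair.2 (Or.inl rfl)), mem_pair.1 (e ▸ mem_pair.2 (Or.inr rfl)),
      mem_pair.1 (e ▸ mem_pair.2 (Or.inl rfl)), mem_pair.1 (e ▸ mem_pair.2 (Or.inr rfl))⟩
  obtain ⟨h1, h2, h3, h4⟩ := hp h
  have hac : a = c := by
    rcases h1 with h1 | h1
    · have := hp h1; grind
    · have := hp h1; grind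
  subst hac
  rcases h2 with h2 | h2
  · have := hp h2; rcases h4 with h4 | h4 <;> have := hp h4 <;> grind
  · have := hp h2; grind

/-- The power set of `A`. -/
def powerset (A : ASet) : ASet := hull fun x => x ⊆ A

theorem mem_powerset {A x : ASet} : x ∈ powerset A ↔ x ⊆ A := by
  refine ⟨fun h z hz n => ?_, fun h => subset_hull h⟩
  obtain ⟨y, hy, e⟩ := h (n + 1)
  have e' : level y n = level x n := e
  have hzn : z.F n ∈ level y n := e' ▸ hz n
  obtain ⟨w, hw, ew⟩ := exists_mem_of_level hzn
  exact ew ▸ hy w hw n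

/-- `R` is a relation between the elements of `A` and the elements of `B`:
a set of ordered pairs `(a, b)` with `a ∈ A` and `b ∈ B`. -/
def IsRelation (R A B : ASet) : Prop :=
  ∀ x : ASet, x ∈ R → ∃ a b : ASet, a ∈ A ∧ b ∈ B ∧ x = opair a b

/-- `f` is a function `A → B`: a total functional relation between elements of `A` and `B`. -/
structure IsFunction (f A B : ASet) : Prop where
  isRelation : IsRelation f A B
  total : ∀ a : ASet, a ∈ A → ∃ b : ASet, b ∈ B ∧ opair a b ∈ f
  functional : ∀ a b b' : ASet, opair a b ∈ f → opair a b' ∈ f → b = b'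

/-- `f` is an injection from `A` into `B`. -/
structure IsInjection (f A B : ASet) : Prop extends IsFunction f A B where
  injective : ∀ a a' b : ASet, opair a b ∈ f → opair a' b ∈ f → a = a'

/-- `f` is a bijection from `A` to `B`. -/
structure IsBijection (f A B : ASet) : Prop extends IsInjection f A B where
  surjective : ∀ b : ASet, b ∈ B → ∃ a : ASet, a ∈ A ∧ opair a b ∈ f

/-- `A ≤_c B`. -/
def LeCard (A B : ASet) : Prop := ∃ f : ASet, IsInjection f A B

/-- `A =_c B`. -/
def EqCard (A B : ASet) : Prop := LeCard A B ∧ LeCard B A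

/-- `A <_c B`. -/
def LtCard (A B : ASet) : Prop := LeCard A B ∧ ¬ EqCard A B

/-- A set is infinite if it is in bijection with one of its proper subsets. -/
def IsInfinite (A : ASet) : Prop := ∃ B f : ASet, B ⊆ A ∧ B ≠ A ∧ IsBijection f A B

/-- The set `R` well-orders `A`. Here `R` is a relation between elements of `A`, and `x < y` means
that `x` and `y` are different and `(x, y) ∈ R`. (Pairs `(x, x)` in `R` are disregarded, as a set
containing `(x, y)` for all `x < y` in an infinite `A` always contains some `(x, x)`.) -/
structure WellOrders (R A : ASet) : Prop where
  isRelation : IsRelation R A A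
  asymm : ∀ x y : ASet, x ≠ y → opair x y ∈ R → opair y x ∉ R
  trans : ∀ x y z : ASet, x ≠ y → y ≠ z → opair x y ∈ R → opair y z ∈ R → opair x z ∈ R
  total : ∀ x y : ASet, x ∈ A → y ∈ A → x ≠ y → opair x y ∈ R ∨ opair y x ∈ R
  /-- Every nonempty subset of `A` has a minimal element. -/
  exists_min : ∀ S : ASet, S ⊆ A → S ≠ empty →
    ∃ m : ASet, m ∈ S ∧ ∀ y : ASet, y ∈ S → y ≠ m → opair m y ∈ R
  /-- Every `x ∈ A` is upward isolated: some neighbourhood `{y | F(n, y) = F(n, x)}` of `x`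
  contains no `y ∈ A` with `x < y`. -/
  upward_isolated : ∀ x : ASet, x ∈ A →
    ∃ n, ∀ y : ASet, y ∈ A → y.F n = x.F n → ¬ (x ≠ y ∧ opair x y ∈ R)

/-- `A` is well-orderable. -/
def WellOrderable (A : ASet) : Prop := ∃ R : ASet, WellOrders R A

/-- `f` is a choice function on the indexed system `I` with index set `J`: a function with domain
`J` such that `f(j) ∈ A_j` for all `j ∈ J`, where `A_j` is the set with `(j, A_j) ∈ I`. -/
def IsChoiceFunction (f I J : ASet) : Prop :=
  (∃ B : ASet, IsFunction f J B) ∧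
    ∀ j a X : ASet, opair j a ∈ f → opair j X ∈ I → a ∈ X

/-- The product `∏_{j ∈ J} A_j` of the indexed system `I = {(j, A_j) | j ∈ J}`: the smallest set
containing all choice functions on `I`. -/
def product (I J : ASet) : ASet := hull fun f => IsChoiceFunction f I J

/-- `A ^ B`: the smallest set containing all functions `B → A`. -/
def power (A B : ASet) : ASet := hull fun f => IsFunction f B A

/-- The set `A ∪ {a}`. -/
def adjoin (A a : ASet) : ASet := hull fun x => x ∈ A ∨ x = a

theorem mem_adjoin {A a x : ASet} : x ∈ adjoin A a ↔ x ∈ A ∨ x = a := by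
  refine ⟨fun h => ?_, fun h => subset_hull h⟩
  by_contra hne
  push Not at hne
  obtain ⟨hA, ha⟩ := hne
  obtain ⟨m, hm⟩ : ∃ m, x.F m ∉ level A m := by
    by_contra hc; push Not at hc; exact hA hc
  obtain ⟨k, hk⟩ : ∃ k, x.F k ≠ a.F k := by
    by_contra hc; push Not at hc; exact ha (ASet.ext (funext hc))
  obtain ⟨y, hyA | rfl, hy⟩ := h (max m k)
  · exact hm (F_eq_of_le (le_max_left m k) hy ▸ hyA m)
  · exact hk (F_eq_of_le (le_max_right m k) hy.symm)

/-- The finite von Neumann ordinals: `0 = {}` and `n + 1 = n ∪ {n}`. -/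
def ordinal : ℕ → ASet
  | 0 => empty
  | n + 1 => adjoin (ordinal n) (ordinal n)

/-- `ω`: the smallest set containing all finite von Neumann ordinals. -/
def omega : ASet := hull fun x => ∃ n, x = ordinal n

end AS

namespace AS

open Set Topology

/-! ### The universe as a compact space -/

/-! Coherent sequences form a closed subspace of a product of finite discrete spaces, so the
universe is a compact Polish space. The sets are its closed subsets (a hull is a topological
closure), and the functions between sets are the continuous maps. Two facts then turn the theorem
into a matter of counting: a set is well-orderable exactly when it is countable
(`wellOrderable_iff_countable`), and every set injects into every uncountable set, since an
uncountable closed set contains a copy of Cantor space (`leCard_of_not_countable`).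

Each factor with nonempty companions embeds in the product through continuous choice functions
(`IsSystem.countable_of_countable_product`). If infinitely many factors are nontrivial, limits of
choice functions code all subsets of `ℕ` (`IsSystem.not_countable_product`). If only finitely many
are, their indices are isolated in `J`, so an element of the product is determined by its values at
these indices (`IsSystem.countable_product`). For powers it remains to see that both sides are
uncountable. -/

instance (n : ℕ) : TopologicalSpace (Approx n) := ⊥

instance (n : ℕ) : DiscreteTopology (Approx n) := ⟨rfl⟩

instance instFiniteApprox : (n : ℕ) → Finite (Approx n)
  | 0 => inferInstanceAs (Finite Unit)
  | n + 1 =>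
    haveI := instFiniteApprox n
    inferInstanceAs (Finite (Set (Approx n)))

instance : TopologicalSpace ASet := TopologicalSpace.induced ASet.F inferInstance

theorem isClosedEmbedding_F : IsClosedEmbedding ASet.F := by
  refine ⟨⟨⟨rfl⟩, fun x y h => ASet.ext h⟩, ?_⟩
  have hr : range ASet.F = ⋂ n, {f : (n : ℕ) → Approx n | trunc n (f (n + 1)) = f n} := by
    ext f
    simp only [mem_range, mem_iInter, mem_ofPred_eq]
    exact ⟨by rintro ⟨x, rfl⟩ n; exact x.coherent n, fun h => ⟨⟨f, h⟩, rfl⟩⟩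
  rw [hr]
  refine isClosed_iInter fun n => isClosed_eq ?_ (continuous_apply n)
  exact continuous_of_discreteTopology.comp (continuous_apply (n + 1))

instance : CompactSpace ASet := isClosedEmbedding_F.compactSpace

instance : T2Space ASet := isClosedEmbedding_F.isEmbedding.t2Space

instance : PolishSpace ASet := isClosedEmbedding_F.polishSpace

theorem continuous_F (n : ℕ) : Continuous fun x : ASet => x.F n :=
  (continuous_apply n).comp isClosedEmbedding_F.continuous

theorem isClopen_F (n : ℕ) (s : Set (Approx n)) : IsClopen {x : ASet | x.F n ∈ s} :=
  (isClopen_discrete s).preimage (continuous_F n)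

theorem continuousOn_iff {X : Type*} [TopologicalSpace X] {g : X → ASet} {s : Set X} :
    ContinuousOn g s ↔ ∀ n, ContinuousOn (fun x => (g x).F n) s := by
  rw [isClosedEmbedding_F.isInducing.continuousOn_iff, continuousOn_pi]
  rfl

theorem continuous_iff {X : Type*} [TopologicalSpace X] {g : X → ASet} :
    Continuous g ↔ ∀ n, Continuous (fun x => (g x).F n) := by
  rw [isClosedEmbedding_F.isInducing.continuous_iff, continuous_pi_iff]
  rfl

theorem ne_iff_exists {x y : ASet} : x ≠ y ↔ ∃ n, x.F n ≠ y.F n := by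
  refine ⟨fun h => ?_, fun ⟨n, hn⟩ h => hn (h ▸ rfl)⟩
  by_contra! hc
  exact h (ASet.ext (funext hc))

theorem F_ne_of_le {x y : ASet} {m n : ℕ} (hmn : m ≤ n) (h : x.F m ≠ y.F m) : x.F n ≠ y.F n :=
  fun e => h (F_eq_of_le hmn e)

/-- The cylinders around `x` decrease to `{x}`, so by compactness one of them misses the complement
of a given open neighbourhood. -/
theorem mem_nhds_iff_F {x : ASet} {s : Set ASet} :
    s ∈ 𝓝 x ↔ ∃ n, ∀ y : ASet, y.F n = x.F n → y ∈ s := by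
  constructor
  · intro hs
    by_contra! hc
    obtain ⟨u, hus, hu, hxu⟩ := mem_nhds_iff.1 hs
    have : (⋂ n, {y : ASet | y.F n = x.F n} ∩ uᶜ).Nonempty := by
      refine IsCompact.nonempty_iInter_of_sequence_nonempty_isCompact_isClosed _ ?_ ?_ ?_ ?_
      · exact fun n y hy => ⟨F_eq_of_le n.le_succ hy.1, hy.2⟩
      · intro n
        obtain ⟨y, hy, hys⟩ := hc n
        exact ⟨y, hy, fun h => hys (hus h)⟩
      · exact ((isClopen_F 0 {x.F 0}).1.inter hu.isClosed_compl).isCompact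
      · exact fun n => (isClopen_F n {x.F n}).1.inter hu.isClosed_compl
    obtain ⟨y, hy⟩ := this
    simp only [mem_iInter, mem_inter_iff, mem_ofPred_eq] at hy
    obtain rfl : y = x := ASet.ext (funext fun n => (hy n).1)
    exact (hy 0).2 hxu
  · rintro ⟨n, hn⟩
    exact Filter.mem_of_superset ((isClopen_F n {x.F n}).2.mem_nhds rfl) hn

theorem continuousOn_of_F {g : ASet → ASet} {s : Set ASet}
    (h : ∀ n, ∃ m, ∀ x ∈ s, ∀ y ∈ s, x.F m = y.F m → (g x).F n = (g y).F n) :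
    ContinuousOn g s := by
  refine continuousOn_iff.2 fun n x hx => ?_
  obtain ⟨m, hm⟩ := h n
  refine (continuousWithinAt_const (b := (g x).F n)).congr_of_eventuallyEq ?_ rfl
  filter_upwards [self_mem_nhdsWithin,
    mem_nhdsWithin_of_mem_nhds (mem_nhds_iff_F.2 ⟨m, fun y hy => hy⟩)] with y hys hy
  exact hm y hys x hx hy

/-- The set of all elements of `A`. -/
def carrier (A : ASet) : Set ASet := {x | x ∈ A}

theorem isClosed_mem : IsClosed {p : ASet × ASet | p.1 ∈ p.2} := by
  have : {p : ASet × ASet | p.1 ∈ p.2} = ⋂ n, {p : ASet × ASet | p.1.F n ∈ level p.2 n} := by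
    ext p; simp [mem_iff]
  rw [this]
  refine isClosed_iInter fun n => ?_
  have hc : Continuous fun p : ASet × ASet => (p.1.F n, p.2.F (n + 1)) :=
    ((continuous_F n).comp continuous_fst).prodMk ((continuous_F (n + 1)).comp continuous_snd)
  exact (isClosed_discrete {q : Approx n × Approx (n + 1) | q.1 ∈ (show Set (Approx n) from q.2)}).preimage hc

theorem isClosed_carrier (A : ASet) : IsClosed (carrier A) :=
  isClosed_mem.preimage (continuous_id.prodMk continuous_const)

theorem isCompact_carrier (A : ASet) : IsCompact (carrier A) := (isClosed_carrier A).isCompact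

/-- The hull is the topological closure, so closed properties pass from the generators to all
elements. -/
theorem mem_of_mem_hull {P : ASet → Prop} {C : Set ASet} (hC : IsClosed C) (h : ∀ x, P x → x ∈ C)
    {x : ASet} (hx : x ∈ hull P) : x ∈ C := by
  rw [← hC.closure_eq, mem_closure_iff_nhds]
  intro s hs
  obtain ⟨n, hn⟩ := mem_nhds_iff_F.1 hs
  obtain ⟨y, hy, e⟩ := hx n
  exact ⟨y, hn y e, h y hy⟩

theorem mem_hull_of_isClosed {P : ASet → Prop} (hP : IsClosed {x | P x}) {x : ASet} :
    x ∈ hull P ↔ P x :=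
  ⟨mem_of_mem_hull hP fun _ h => h, subset_hull⟩

theorem eq_empty_iff {A : ASet} : A = empty ↔ ∀ x, x ∉ A :=
  ⟨fun h x hx => not_mem_empty x (h ▸ hx),
    fun h => ext_mem fun x => ⟨fun hx => (h x hx).elim, fun hx => (not_mem_empty x hx).elim⟩⟩

theorem ne_empty_iff {A : ASet} : A ≠ empty ↔ ∃ x, x ∈ A := by
  rw [Ne, eq_empty_iff]; push Not; rfl

theorem exists_mem_of_F_eq {A B x : ASet} {n : ℕ} (h : A.F (n + 1) = B.F (n + 1)) (hx : x ∈ A) :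
    ∃ y ∈ B, y.F n = x.F n := by
  have : level A n = level B n := h
  exact exists_mem_of_level (this ▸ hx n)

/-! ### Ordered pairs -/

theorem level_pair (a b : ASet) (n : ℕ) : level (pair a b) n = {a.F n, b.F n} := by
  ext c
  change (∃ x, (x = a ∨ x = b) ∧ x.F n = c) ↔ _
  simp [eq_comm]

theorem pair_F_inj {a b c d : ASet} {n : ℕ} :
    (pair a b).F (n + 1) = (pair c d).F (n + 1) ↔
      ({a.F n, b.F n} : Set (Approx n)) = {c.F n, d.F n} := by
  rw [← level_pair, ← level_pair]; rfl

/-- Each of the two nested pairings costs one level, whence the shift by 2. -/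
theorem opair_F_inj {a b c d : ASet} {n : ℕ} :
    (opair a b).F (n + 2) = (opair c d).F (n + 2) ↔ a.F n = c.F n ∧ b.F n = d.F n := by
  unfold opair
  rw [pair_F_inj, pair_eq_pair_iff]
  simp only [single, pair_F_inj, pair_eq_pair_iff]
  grind

theorem opair_F_eq {a b c d : ASet} {n : ℕ} (ha : a.F n = c.F n) (hb : b.F n = d.F n) :
    (opair a b).F n = (opair c d).F n :=
  F_eq_of_le (Nat.le_add_right n 2) (opair_F_inj.2 ⟨ha, hb⟩)

theorem continuous_opair : Continuous fun p : ASet × ASet => opair p.1 p.2 := by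
  refine continuous_iff.2 fun n => continuous_iff_continuousAt.2 fun p => ?_
  refine (continuousAt_const (y := (opair p.1 p.2).F n)).congr ?_
  have h1 : ∀ᶠ q : ASet × ASet in 𝓝 p, q.1.F n = p.1.F n :=
    continuousAt_fst.eventually (mem_nhds_iff_F.2 ⟨n, fun y hy => hy⟩)
  have h2 : ∀ᶠ q : ASet × ASet in 𝓝 p, q.2.F n = p.2.F n :=
    continuousAt_snd.eventually (mem_nhds_iff_F.2 ⟨n, fun y hy => hy⟩)
  filter_upwards [h1, h2] with q hq1 hq2
  exact (opair_F_eq hq1 hq2).symm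

/-! ### Functions and continuous maps -/

/-- The graph of the restriction of `g` to `A`. -/
def graph (A : ASet) (g : ASet → ASet) : ASet := hull fun x => ∃ a ∈ A, x = opair a (g a)

/-- The graph of a continuous map on a compact set is compact, so the hull adds nothing. -/
theorem mem_graph {A : ASet} {g : ASet → ASet} (hg : ContinuousOn g (carrier A)) {x : ASet} :
    x ∈ graph A g ↔ ∃ a ∈ A, x = opair a (g a) := by
  refine mem_hull_of_isClosed (P := fun x => ∃ a ∈ A, x = opair a (g a)) ?_
  have : {x | ∃ a ∈ A, x = opair a (g a)} = (fun a => opair a (g a)) '' carrier A := by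
    ext x; simp only [carrier, mem_image, mem_ofPred_eq, eq_comm]
  rw [this]
  exact ((isCompact_carrier A).image_of_continuousOn
    (continuous_opair.comp_continuousOn (continuousOn_id.prodMk hg))).isClosed

theorem opair_mem_graph {A : ASet} {g : ASet → ASet} (hg : ContinuousOn g (carrier A))
    {a b : ASet} : opair a b ∈ graph A g ↔ a ∈ A ∧ b = g a := by
  rw [mem_graph hg]
  constructor
  · rintro ⟨c, hc, e⟩
    obtain ⟨rfl, rfl⟩ := opair_inj.1 e
    exact ⟨hc, rfl⟩
  · rintro ⟨ha, rfl⟩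
    exact ⟨a, ha, rfl⟩

theorem isFunction_graph {A B : ASet} {g : ASet → ASet} (hg : ContinuousOn g (carrier A))
    (hB : ∀ a ∈ A, g a ∈ B) : IsFunction (graph A g) A B where
  isRelation x hx := by
    obtain ⟨a, ha, rfl⟩ := (mem_graph hg).1 hx
    exact ⟨a, g a, ha, hB a ha, rfl⟩
  total a ha := ⟨g a, hB a ha, (opair_mem_graph hg).2 ⟨ha, rfl⟩⟩
  functional a b b' h h' := by
    rw [opair_mem_graph hg] at h h'
    rw [h.2, h'.2]

theorem leCard_of_injOn {A B : ASet} {g : ASet → ASet} (hg : ContinuousOn g (carrier A))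
    (hB : ∀ a ∈ A, g a ∈ B) (hi : ∀ a ∈ A, ∀ a' ∈ A, g a = g a' → a = a') : LeCard A B :=
  ⟨graph A g, isFunction_graph hg hB, fun a a' b h h' => by
    rw [opair_mem_graph hg] at h h'
    exact hi a h.1 a' h'.1 (h.2.symm.trans h'.2)⟩

theorem IsFunction.mem {f A B a b : ASet} (hf : IsFunction f A B) (h : opair a b ∈ f) :
    a ∈ A ∧ b ∈ B := by
  obtain ⟨a', b', ha, hb, e⟩ := hf.isRelation _ h
  obtain ⟨rfl, rfl⟩ := opair_inj.1 e
  exact ⟨ha, hb⟩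

/-- Functions are uniformly continuous. -/
theorem IsFunction.exists_F {f A B : ASet} (hf : IsFunction f A B) (n : ℕ) :
    ∃ m, ∀ x y x' y' : ASet, opair x y ∈ f → opair x' y' ∈ f → x.F m = x'.F m →
      y.F n = y'.F n := by
  by_contra! hc
  -- Pairs of points of `f` that violate the claim at level `m`. A common point of these nested
  -- compact sets would give one argument two values.
  let t : ℕ → Set ((ASet × ASet) × (ASet × ASet)) := fun m =>
    {p | opair p.1.1 p.1.2 ∈ f} ∩ {p | opair p.2.1 p.2.2 ∈ f} ∩
      {p | p.1.1.F m = p.2.1.F m} ∩ {p | p.1.2.F n ≠ p.2.2.F n}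
  have hcl : ∀ m, IsClosed (t m) := by
    intro m
    refine IsClosed.inter (IsClosed.inter (IsClosed.inter ?_ ?_) ?_) ?_
    · exact (isClosed_carrier f).preimage (continuous_opair.comp continuous_fst)
    · exact (isClosed_carrier f).preimage (continuous_opair.comp continuous_snd)
    · exact isClosed_eq ((continuous_F m).comp (continuous_fst.comp continuous_fst))
        ((continuous_F m).comp (continuous_fst.comp continuous_snd))
    · have : Continuous fun p : (ASet × ASet) × (ASet × ASet) => (p.1.2.F n, p.2.2.F n) :=
        ((continuous_F n).comp (continuous_snd.comp continuous_fst)).prodMk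
          ((continuous_F n).comp (continuous_snd.comp continuous_snd))
      exact (isClosed_discrete {q : Approx n × Approx n | q.1 ≠ q.2}).preimage this
  obtain ⟨p, hp⟩ : (⋂ m, t m).Nonempty := by
    refine IsCompact.nonempty_iInter_of_sequence_nonempty_isCompact_isClosed t ?_ ?_
      (hcl 0).isCompact hcl
    · rintro m p ⟨⟨⟨h1, h2⟩, h3⟩, h4⟩
      exact ⟨⟨⟨h1, h2⟩, F_eq_of_le m.le_succ h3⟩, h4⟩
    · intro m
      obtain ⟨x, y, x', y', h1, h2, h3, h4⟩ := hc m
      exact ⟨((x, y), (x', y')), ⟨⟨h1, h2⟩, h3⟩, h4⟩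
  rw [mem_iInter] at hp
  obtain ⟨⟨⟨h1, h2⟩, -⟩, h4⟩ := hp 0
  have e : p.1.1 = p.2.1 := ASet.ext (funext fun m => (hp m).1.2)
  simp only [mem_ofPred_eq] at h1 h2 h4
  rw [e] at h1
  exact h4 (hf.functional _ _ _ h1 h2 ▸ rfl)

/-- The map underlying a function. -/
theorem IsFunction.exists_map {f A B : ASet} (hf : IsFunction f A B) :
    ∃ g : ASet → ASet, (∀ a ∈ A, g a ∈ B) ∧ (∀ a b, opair a b ∈ f ↔ a ∈ A ∧ b = g a) ∧
      ∀ n, ∃ m, ∀ x ∈ A, ∀ y ∈ A, x.F m = y.F m → (g x).F n = (g y).F n := by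
  choose! g hg using hf.total
  refine ⟨g, fun a ha => (hg a ha).1, fun a b => ⟨fun h => ?_, ?_⟩, fun n => ?_⟩
  · have ha := (hf.mem h).1
    exact ⟨ha, hf.functional a _ _ h (hg a ha).2⟩
  · rintro ⟨ha, rfl⟩
    exact (hg a ha).2
  · obtain ⟨m, hm⟩ := hf.exists_F n
    exact ⟨m, fun x hx y hy e => hm x _ y _ (hg x hx).2 (hg y hy).2 e⟩

/-- Every set injects into every uncountable set. -/
theorem leCard_of_not_countable (A : ASet) {B : ASet} (hB : ¬ (carrier B).Countable) :
    LeCard A B := by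
  obtain ⟨f, hf, hc, hi⟩ := (isClosed_carrier B).exists_nat_bool_injection_of_not_countable hB
  have : Countable (Σ n, Approx n) := inferInstance
  obtain ⟨e, he⟩ := exists_injective_nat (Σ n, Approx n)
  classical
  -- The characteristic function of the set of codes of all approximations of `x` embeds the
  -- universe in Cantor space.
  let c : ASet → ℕ → Bool := fun x i => decide (∃ n, e ⟨n, x.F n⟩ = i)
  have hci : Function.Injective c := by
    intro x y h
    refine ASet.ext (funext fun n => ?_)
    have h1 : c x (e ⟨n, x.F n⟩) = true := decide_eq_true ⟨n, rfl⟩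
    rw [h] at h1
    obtain ⟨m, hm⟩ := of_decide_eq_true h1
    have := he hm
    grind
  have hcc : Continuous c := by
    refine continuous_pi fun i => ?_
    by_cases hi : ∃ n a, e ⟨n, a⟩ = i
    · obtain ⟨n, a, rfl⟩ := hi
      have : (fun x => c x (e ⟨n, a⟩)) = fun x : ASet => decide (x.F n = a) := by
        ext x
        have : (∃ m, e ⟨m, x.F m⟩ = e ⟨n, a⟩) ↔ x.F n = a := by
          constructor
          · rintro ⟨m, hm⟩
            have := he hm
            grind
          · rintro rfl
            exact ⟨n, rfl⟩
        simp only [c, this]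
      rw [this]
      exact (continuous_of_discreteTopology (f := fun b : Approx n => decide (b = a))).comp
        (continuous_F n)
    · have : (fun x => c x i) = fun _ => false := by
        ext x
        exact decide_eq_false fun ⟨n, hn⟩ => hi ⟨n, _, hn⟩
      rw [this]
      exact continuous_const
  exact leCard_of_injOn (hc.comp hcc).continuousOn (fun a _ => hf ⟨c a, rfl⟩)
    fun a _ a' _ h => hci (hi h)

/-! ### Well-orderable sets are the countable sets -/

/-- Two elements upward isolated at the same level `n` are comparable, so their `n`-th
approximations differ; only finitely many approximations exist at each level. -/
theorem WellOrderable.countable {A : ASet} (h : WellOrderable A) : (carrier A).Countable := by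
  obtain ⟨R, hR⟩ := h
  let s : ℕ → Set ASet := fun n =>
    {x | x ∈ A ∧ ∀ y ∈ A, y.F n = x.F n → ¬ (x ≠ y ∧ opair x y ∈ R)}
  have hs : carrier A ⊆ ⋃ n, s n := fun x hx => by
    obtain ⟨n, hn⟩ := hR.upward_isolated x hx
    exact mem_iUnion.2 ⟨n, hx, hn⟩
  refine (countable_iUnion fun n => ?_).mono hs
  refine Finite.countable (Finite.of_finite_image (f := fun x => x.F n) (toFinite _) ?_)
  intro x hx y hy e
  by_contra hne
  rcases hR.total x y hx.1 hy.1 hne with h | h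
  · exact hx.2 y hy.1 e.symm ⟨hne, h⟩
  · exact hy.2 x hx.1 e ⟨Ne.symm hne, h⟩

/-- The least index of an element of `A` whose `k`-th approximation is that of `x`. -/
noncomputable def minIndex (A : ASet) (e : ASet → ℕ) (x : ASet) (k : ℕ) : ℕ :=
  sInf (e '' {z | z ∈ A ∧ z.F k = x.F k})

theorem minIndex_congr {A : ASet} {e : ASet → ℕ} {x y : ASet} {k : ℕ} (h : x.F k = y.F k) :
    minIndex A e x k = minIndex A e y k := by
  unfold minIndex
  rw [h]

theorem minIndex_le {A : ASet} {e : ASet → ℕ} {x z : ASet} {k : ℕ} (hz : z ∈ A)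
    (h : z.F k = x.F k) : minIndex A e x k ≤ e z :=
  Nat.sInf_le ⟨z, ⟨hz, h⟩, rfl⟩

theorem exists_minIndex {A : ASet} (e : ASet → ℕ) {x : ASet} (hx : x ∈ A) (k : ℕ) :
    ∃ z ∈ A, z.F k = x.F k ∧ e z = minIndex A e x k := by
  obtain ⟨z, ⟨hz, h⟩, h'⟩ : minIndex A e x k ∈ e '' {z | z ∈ A ∧ z.F k = x.F k} :=
    Nat.sInf_mem ⟨e x, x, ⟨hx, rfl⟩, rfl⟩
  exact ⟨z, hz, h, h'⟩

theorem F_eq_of_minIndex_eq {A : ASet} {e : ASet → ℕ} (he : InjOn e (carrier A)) {x y : ASet}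
    (hx : x ∈ A) (hy : y ∈ A) {k : ℕ} (h : minIndex A e x k = minIndex A e y k) :
    x.F k = y.F k := by
  obtain ⟨z, hz, h1, h2⟩ := exists_minIndex e hx k
  obtain ⟨w, hw, h3, h4⟩ := exists_minIndex e hy k
  obtain rfl : z = w := he hz hw (by rw [h2, h4, h])
  rw [← h1, h3]

/-- The reverse of the lexicographic order of the sequences of minimal indices. -/
def IndexLE (A : ASet) (e : ASet → ℕ) (x y : ASet) : Prop :=
  toLex (minIndex A e y) ≤ toLex (minIndex A e x)

/-- Failure is visible at a finite level, which makes the relation closed. -/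
theorem not_indexLE {A : ASet} {e : ASet → ℕ} {x y : ASet} :
    ¬ IndexLE A e x y ↔ ∃ k, (∀ j < k, minIndex A e x j = minIndex A e y j) ∧
      minIndex A e x k < minIndex A e y k := by
  rw [IndexLE, not_le]
  rfl

/-- The relation `IndexLE` on `A`. -/
def indexRel (A : ASet) (e : ASet → ℕ) : ASet :=
  hull fun p => ∃ x y, x ∈ A ∧ y ∈ A ∧ IndexLE A e x y ∧ p = opair x y

theorem mem_indexRel {A : ASet} {e : ASet → ℕ} {p : ASet} :
    p ∈ indexRel A e ↔ ∃ x y, x ∈ A ∧ y ∈ A ∧ IndexLE A e x y ∧ p = opair x y := by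
  refine mem_hull_of_isClosed
    (P := fun p => ∃ x y, x ∈ A ∧ y ∈ A ∧ IndexLE A e x y ∧ p = opair x y) ?_
  have hcl : IsClosed {q : ASet × ASet | IndexLE A e q.1 q.2} := by
    rw [← isOpen_compl_iff, isOpen_iff_mem_nhds]
    intro q hq
    obtain ⟨k, hk, hlt⟩ := not_indexLE.1 hq
    have h1 : ∀ᶠ r : ASet × ASet in 𝓝 q, r.1.F k = q.1.F k :=
      continuousAt_fst.eventually (mem_nhds_iff_F.2 ⟨k, fun y hy => hy⟩)
    have h2 : ∀ᶠ r : ASet × ASet in 𝓝 q, r.2.F k = q.2.F k :=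
      continuousAt_snd.eventually (mem_nhds_iff_F.2 ⟨k, fun y hy => hy⟩)
    filter_upwards [h1, h2] with r hr1 hr2
    refine not_indexLE.2 ⟨k, fun j hj => ?_, ?_⟩
    · rw [minIndex_congr (F_eq_of_le hj.le hr1), minIndex_congr (F_eq_of_le hj.le hr2), hk j hj]
    · rwa [minIndex_congr hr1, minIndex_congr hr2]
  have hA : IsClosed (carrier A ×ˢ carrier A ∩ {q : ASet × ASet | IndexLE A e q.1 q.2}) :=
    ((isClosed_carrier A).prod (isClosed_carrier A)).inter hcl
  convert (hA.isCompact.image continuous_opair).isClosed using 1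
  ext p
  constructor
  · rintro ⟨x, y, hx, hy, h, rfl⟩
    exact ⟨(x, y), ⟨⟨hx, hy⟩, h⟩, rfl⟩
  · rintro ⟨⟨x, y⟩, ⟨⟨hx, hy⟩, h⟩, rfl⟩
    exact ⟨x, y, hx, hy, h, rfl⟩

theorem opair_mem_indexRel {A : ASet} {e : ASet → ℕ} {x y : ASet} :
    opair x y ∈ indexRel A e ↔ x ∈ A ∧ y ∈ A ∧ IndexLE A e x y := by
  rw [mem_indexRel]
  constructor
  · rintro ⟨a, b, ha, hb, h, hab⟩
    obtain ⟨rfl, rfl⟩ := opair_inj.1 hab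
    exact ⟨ha, hb, h⟩
  · rintro ⟨hx, hy, h⟩
    exact ⟨x, y, hx, hy, h, rfl⟩

/-- Minima exist because initial segments are compact. For upward isolation, take a neighbourhood of
`x` free of the finitely many elements of smaller index: below it, the first difference from any `y`
gives `y` the larger minimal index, so `y` precedes `x`. -/
theorem wellOrders_indexRel {A : ASet} {e : ASet → ℕ} (he : InjOn e (carrier A)) :
    WellOrders (indexRel A e) A where
  isRelation p hp := by
    obtain ⟨x, y, hx, hy, -, rfl⟩ := mem_indexRel.1 hp
    exact ⟨x, y, hx, hy, rfl⟩
  asymm x y hne h h' := by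
    rw [opair_mem_indexRel] at h h'
    have : minIndex A e x = minIndex A e y := toLex.injective (le_antisymm h'.2.2 h.2.2)
    exact hne (ASet.ext (funext fun k => F_eq_of_minIndex_eq he h.1 h.2.1 (congrFun this k)))
  trans x y z _ _ h h' := by
    rw [opair_mem_indexRel] at h h' ⊢
    exact ⟨h.1, h'.2.1, le_trans h'.2.2 h.2.2⟩
  total x y hx hy _ := by
    rw [opair_mem_indexRel, opair_mem_indexRel]
    rcases le_total (toLex (minIndex A e y)) (toLex (minIndex A e x)) with h | h
    · exact Or.inl ⟨hx, hy, h⟩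
    · exact Or.inr ⟨hy, hx, h⟩
  exists_min S hS hne := by
    obtain ⟨x₀, hx₀⟩ := ne_empty_iff.1 hne
    have : Nonempty (carrier S) := ⟨⟨x₀, hx₀⟩⟩
    let t : carrier S → Set ASet := fun x => carrier S ∩ {y | opair y x ∈ indexRel A e}
    have hcl : ∀ x, IsClosed (t x) := fun x => (isClosed_carrier S).inter
      ((isClosed_carrier _).preimage (continuous_opair.comp (continuous_id.prodMk continuous_const)))
    obtain ⟨m, hm⟩ : (⋂ x, t x).Nonempty := by
      refine IsCompact.nonempty_iInter_of_directed_nonempty_isCompact_isClosed t ?_ ?_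
        (fun x => (hcl x).isCompact) hcl
      · have key : ∀ x y : carrier S, IndexLE A e x y → t x ⊆ t y := by
          rintro x y h z ⟨hz, hz'⟩
          have hz' := opair_mem_indexRel.1 hz'
          exact ⟨hz, opair_mem_indexRel.2 ⟨hz'.1, hS _ y.2, le_trans h hz'.2.2⟩⟩
        intro x y
        rcases le_total (toLex (minIndex A e y)) (toLex (minIndex A e x)) with h | h
        · exact ⟨x, subset_rfl, key x y h⟩
        · exact ⟨y, key y x h, subset_rfl⟩
      · exact fun x => ⟨x, x.2, opair_mem_indexRel.2 ⟨hS _ x.2, hS _ x.2, le_rfl⟩⟩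
    rw [mem_iInter] at hm
    exact ⟨m, (hm ⟨x₀, hx₀⟩).1, fun y hy _ => (hm ⟨y, hy⟩).2⟩
  upward_isolated x hx := by
    have hfin : {z | z ∈ A ∧ e z < e x}.Finite := by
      refine Finite.of_finite_image (f := e) ((finite_Iio (e x)).subset ?_)
        (he.mono fun z hz => hz.1)
      rintro _ ⟨z, hz, rfl⟩
      exact hz.2
    have hn : ∀ᶠ n in Filter.atTop, ∀ z ∈ {z | z ∈ A ∧ e z < e x}, z.F n ≠ x.F n := by
      rw [Filter.eventually_all_finite hfin]
      rintro z ⟨-, hz⟩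
      obtain ⟨n, hn⟩ := ne_iff_exists.1 (show z ≠ x by rintro rfl; exact lt_irrefl _ hz)
      exact Filter.eventually_atTop.2 ⟨n, fun m hm => F_ne_of_le hm hn⟩
    obtain ⟨n, hn⟩ := hn.exists
    refine ⟨n, ?_⟩
    rintro y hy hyx ⟨hne, h⟩
    have hle := (opair_mem_indexRel.1 h).2.2
    refine hle.not_gt ?_
    have hd : ∃ k, x.F k ≠ y.F k := ne_iff_exists.1 hne
    classical
    refine ⟨Nat.find hd, fun j hj => minIndex_congr (not_not.1 (Nat.find_min hd hj)), ?_⟩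
    have hk := Nat.find_spec hd
    set k := Nat.find hd
    refine lt_of_le_of_ne ?_ fun h' => hk (F_eq_of_minIndex_eq he hx hy h')
    obtain ⟨z, hz, hzy, hez⟩ := exists_minIndex e hy k
    have hnk : n ≤ k := by
      by_contra! hlt
      exact hk (F_eq_of_le hlt.le hyx.symm)
    have : ¬ e z < e x := fun hlt => hn z ⟨hz, hlt⟩ ((F_eq_of_le hnk hzy).trans hyx)
    exact (minIndex_le hx rfl).trans ((not_lt.1 this).trans_eq hez)

theorem wellOrderable_iff_countable {A : ASet} : WellOrderable A ↔ (carrier A).Countable := by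
  refine ⟨WellOrderable.countable, fun h => ?_⟩
  obtain ⟨e, he⟩ := countable_iff_exists_injOn.1 h
  exact ⟨_, wellOrders_indexRel he⟩

/-! ### Discrete sequences -/

/-- Every infinite collection of sets contains a sequence with disjoint neighbourhoods. -/
theorem exists_disjoint_seq {D : Set ASet} (hD : D.Infinite) :
    ∃ (d : ℕ → ASet) (M : ℕ → ℕ), (∀ i, d i ∈ D) ∧
      ∀ i k (z : ASet), z.F (M i) = (d i).F (M i) → z.F (M k) = (d k).F (M k) → i = k := by
  have := hD.to_subtype
  obtain ⟨U, hU, hUo, hd⟩ := exists_seq_infinite_isOpen_pairwise_disjoint D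
  choose d hdU using fun i => (hU i).nonempty
  have : ∀ i, ∃ m, ∀ y : D, y.1.F m = (d i).1.F m → y ∈ U i := by
    intro i
    have := (hUo i).mem_nhds (hdU i)
    rw [nhds_subtype_eq_comap, Filter.mem_comap] at this
    obtain ⟨t, ht, hts⟩ := this
    obtain ⟨m, hm⟩ := mem_nhds_iff_F.1 ht
    exact ⟨m, fun y hy => hts (hm y hy)⟩
  choose M hM using this
  refine ⟨fun i => d i, M, fun i => (d i).2, ?_⟩
  have key : ∀ i k (z : ASet), M i ≤ M k → z.F (M i) = (d i).1.F (M i) →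
      z.F (M k) = (d k).1.F (M k) → i = k := by
    -- The finer of the two cylinders puts `d k` into `U i` as well as `U k`.
    intro i k z hle hi hk
    have h1 : d k ∈ U i := hM i _ ((F_eq_of_le hle hk).symm.trans hi)
    by_contra hne
    exact (disjoint_left.1 (hd hne)) h1 (hdU k)
  intro i k z hi hk
  rcases le_total (M i) (M k) with h | h
  · exact key i k z h hi hk
  · exact (key k i z h hk hi).symm

theorem not_countable_of_injective {A : ASet} {r : Set ℕ → ASet} (hr : ∀ S, r S ∈ A)
    (hi : Function.Injective r) : ¬ (carrier A).Countable := by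
  intro h
  have := h.to_subtype
  have : Countable (Set ℕ) := Function.Injective.countable
    (f := fun S => (⟨r S, hr S⟩ : carrier A)) fun S T e => hi (congrArg Subtype.val e)
  obtain ⟨f, hf⟩ := exists_injective_nat (Set ℕ)
  exact Function.cantor_injective f hf

/-- Each `d i` has a neighbourhood without other terms of the sequence, so closing a subfamily adds
no further `d i`. -/
theorem not_countable_powerset {X : ASet} (hX : (carrier X).Infinite) :
    ¬ (carrier (powerset X)).Countable := by
  obtain ⟨d, M, hd, hM⟩ := exists_disjoint_seq hX
  have key : ∀ (S : Set ℕ) i, d i ∈ hull (fun x => ∃ k ∈ S, x = d k) ↔ i ∈ S := by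
    refine fun S i => ⟨fun h => ?_, fun h => subset_hull ⟨i, h, rfl⟩⟩
    obtain ⟨_, ⟨k, hk, rfl⟩, e⟩ := h (M i)
    rwa [hM i k (d k) e rfl]
  refine not_countable_of_injective (r := fun S => hull fun x => ∃ k ∈ S, x = d k) (fun S => ?_) ?_
  · refine mem_powerset.2 (hull_subset ?_)
    rintro _ ⟨k, -, rfl⟩
    exact hd k
  · intro S T h
    ext i
    rw [← key S i, ← key T i]
    exact iff_of_eq (congrArg (d i ∈ ·) h)

/-! ### Continuous selectors -/

open Classical in
/-- A child of `a` in `L`, which is `b` if possible. -/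
noncomputable def child (n : ℕ) (L : Set (Approx (n + 1))) (a : Approx n) (b : Approx (n + 1)) :
    Approx (n + 1) :=
  if b ∈ L ∧ trunc n b = a then b
  -- This choice depends only on `n`, `L` and `a`, which keeps the selection continuous.
  else if h : ∃ c ∈ L, trunc n c = a then h.choose else b

theorem child_spec {n : ℕ} {L : Set (Approx (n + 1))} {a : Approx n} (b : Approx (n + 1))
    (h : a ∈ trunc n '' L) : child n L a b ∈ L ∧ trunc n (child n L a b) = a := by
  unfold child
  split_ifs with h1 h2
  · exact h1
  · exact h2.choose_spec
  · exact absurd h h2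

/-- The path in `A` that follows `x` as long as possible. -/
noncomputable def selectPath (x A : ASet) : (n : ℕ) → Approx n
  | 0 => x.F 0
  | n + 1 => child n (level A (n + 1)) (selectPath x A n) (x.F (n + 1))

theorem selectPath_mem (x : ASet) {A : ASet} (hA : A ≠ empty) (n : ℕ) :
    selectPath x A n ∈ level A n := by
  induction n with
  | zero =>
    obtain ⟨y, hy⟩ := ne_empty_iff.1 hA
    exact hy 0
  | succ n ih =>
    rw [← image_level] at ih
    exact (child_spec _ ih).1

theorem trunc_selectPath (x : ASet) {A : ASet} (hA : A ≠ empty) (n : ℕ) :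
    trunc n (selectPath x A (n + 1)) = selectPath x A n := by
  have := selectPath_mem x hA n
  rw [← image_level] at this
  exact (child_spec _ this).2

/-- The path up to level `n` reads only finitely many levels of `A`; this gives continuity of
`select` on nonempty sets. -/
theorem selectPath_congr (x : ASet) {A B : ASet} {n : ℕ} (h : A.F (n + 1) = B.F (n + 1)) :
    selectPath x A n = selectPath x B n := by
  induction n with
  | zero => rfl
  | succ n ih =>
    have hl : level A (n + 1) = level B (n + 1) := h
    rw [selectPath, selectPath, hl, ih (F_eq_of_le (Nat.le_succ _) h)]

theorem selectPath_of_mem {x A : ASet} (h : x ∈ A) (n : ℕ) : selectPath x A n = x.F n := by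
  induction n with
  | zero => rfl
  | succ n ih =>
    rw [selectPath, ih, child, if_pos ⟨h (n + 1), x.coherent n⟩]

open Classical in
/-- An element of the nonempty set `A`, which is `x` if `x ∈ A`. It depends continuously on `A`. -/
noncomputable def select (x A : ASet) : ASet :=
  if h : A ≠ empty then ⟨selectPath x A, trunc_selectPath x h⟩ else empty

theorem select_F (x : ASet) {A : ASet} (hA : A ≠ empty) (n : ℕ) :
    (select x A).F n = selectPath x A n := by
  rw [select, dif_pos hA]

theorem select_mem (x : ASet) {A : ASet} (hA : A ≠ empty) : select x A ∈ A := fun n => by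
  rw [select_F x hA]
  exact selectPath_mem x hA n

theorem select_of_mem {x A : ASet} (h : x ∈ A) : select x A = x :=
  ASet.ext (funext fun n => by
    rw [select_F x (ne_empty_iff.2 ⟨x, h⟩), selectPath_of_mem h])

theorem select_F_congr (x : ASet) {A B : ASet} (hA : A ≠ empty) (hB : B ≠ empty) {n : ℕ}
    (h : A.F (n + 1) = B.F (n + 1)) : (select x A).F n = (select x B).F n := by
  rw [select_F x hA, select_F x hB, selectPath_congr x h]

/-! ### Indexed systems -/

/-- `I` is the indexed system `{(j, G j) | j ∈ J}`, where `G` is continuous on `J`. -/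
structure IsSystem (I J : ASet) (G : ASet → ASet) : Prop where
  opair_mem : ∀ j X, opair j X ∈ I ↔ j ∈ J ∧ X = G j
  exists_F : ∀ n, ∃ m, ∀ x ∈ J, ∀ y ∈ J, x.F m = y.F m → (G x).F n = (G y).F n

theorem IsFunction.exists_isSystem {I J B : ASet} (h : IsFunction I J B) :
    ∃ G, IsSystem I J G := by
  obtain ⟨G, -, h1, h2⟩ := h.exists_map
  exact ⟨G, h1, h2⟩

variable {I J : ASet} {G : ASet → ASet}

theorem IsSystem.isChoiceFunction_graph (h : IsSystem I J G) {g : ASet → ASet}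
    (hg : ContinuousOn g (carrier J)) (hG : ∀ j ∈ J, g j ∈ G j) :
    IsChoiceFunction (graph J g) I J := by
  refine ⟨⟨hull fun _ => True, isFunction_graph hg fun _ _ => subset_hull trivial⟩, ?_⟩
  intro j a X ha hX
  obtain ⟨hj, rfl⟩ := (opair_mem_graph hg).1 ha
  rw [((h.opair_mem j X).1 hX).2]
  exact hG j hj

/-- Choosing locally constant preferences yields a continuous selection. -/
theorem IsSystem.continuousOn_select (h : IsSystem I J G) (hne : ∀ j ∈ J, G j ≠ empty)
    {p : ASet → ASet} {N : ℕ} (hp : ∀ j j' : ASet, j.F N = j'.F N → p j = p j') :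
    ContinuousOn (fun j => select (p j) (G j)) (carrier J) := by
  refine continuousOn_of_F fun n => ?_
  obtain ⟨m, hm⟩ := h.exists_F (n + 1)
  refine ⟨max m N, fun x hx y hy e => ?_⟩
  rw [hp x y (F_eq_of_le (le_max_right _ _) e)]
  exact select_F_congr _ (hne x hx) (hne y hy) (hm x hx y hy (F_eq_of_le (le_max_left _ _) e))

/-- Following `x` wherever possible is a continuous choice whose value at `j` is `x` itself, so
distinct elements of `G j` give distinct choice functions. -/
theorem IsSystem.countable_of_countable_product (h : IsSystem I J G)
    (hne : ∀ j ∈ J, G j ≠ empty) (hc : (carrier (product I J)).Countable) {j : ASet} (hj : j ∈ J) :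
    (carrier (G j)).Countable := by
  have hcont : ∀ x, ContinuousOn (fun j => select x (G j)) (carrier J) := fun x =>
    h.continuousOn_select hne (p := fun _ => x) (N := 0) fun _ _ _ => rfl
  refine MapsTo.countable_of_injOn (f := fun x => graph J fun j => select x (G j)) ?_ ?_ hc
  · exact fun x _ => subset_hull
      (h.isChoiceFunction_graph (hcont x) fun j hj => select_mem x (hne j hj))
  · intro x hx y hy e
    have h1 : opair j x ∈ graph J fun j => select x (G j) :=
      (opair_mem_graph (hcont x)).2 ⟨hj, (select_of_mem hx).symm⟩
    have e' : (graph J fun j => select x (G j)) = graph J fun j => select y (G j) := e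
    rw [e', opair_mem_graph (hcont y)] at h1
    exact h1.2.trans (select_of_mem hy)

theorem IsSystem.not_countable_product (h : IsSystem I J G) (hne : ∀ j ∈ J, G j ≠ empty)
    (hD : {j | j ∈ J ∧ (carrier (G j)).Nontrivial}.Infinite) :
    ¬ (carrier (product I J)).Countable := by
  obtain ⟨d, M, hd, hM⟩ := exists_disjoint_seq hD
  choose hdJ hdn using hd
  -- `a i` avoids the default value at `d i`; `m i` is a level showing this, and `k i` is so fine
  -- that indices agreeing with `d i` there have default values agreeing at level `m i`.
  choose a ha hac using fun i => (hdn i).exists_ne (select empty (G (d i)))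
  choose m hm using fun i => ne_iff_exists.1 (hac i)
  choose k hk using fun i => h.exists_F (m i + 1)
  obtain ⟨N, hMN, hmN, hkN⟩ : ∃ N : ℕ → ℕ, (∀ i, M i ≤ N i) ∧ (∀ i, m i ≤ N i) ∧
      ∀ i, k i ≤ N i :=
    ⟨fun i => M i + m i + k i, fun i => by lia, fun i => by lia, fun i => by lia⟩
  have hN : ∀ i i' (z : ASet), z.F (N i) = (d i).F (N i) → z.F (N i') = (d i').F (N i') → i = i' :=
    fun i i' z h1 h2 => hM i i' z (F_eq_of_le (hMN i) h1) (F_eq_of_le (hMN i') h2)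
  -- choice functions with prescribed values at finitely many indices
  have key : ∀ T : Finset ℕ, ∃ f, IsChoiceFunction f I J ∧
      (∀ i ∈ T, opair (d i) (a i) ∈ f) ∧
      ∀ i ∉ T, (opair (d i) (a i)).F (N i + 2) ∉ level f (N i + 2) := by
    intro T
    classical
    -- Prefer `a i` near `d i` for `i ∈ T`, and the default elsewhere; by `hN` at most one `i`
    -- applies.
    let p : ASet → ASet := fun j =>
      if h : ∃ i ∈ T, j.F (N i) = (d i).F (N i) then a h.choose else empty
    have hp1 : ∀ i ∈ T, p (d i) = a i := by
      intro i hi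
      have hex : ∃ i' ∈ T, (d i).F (N i') = (d i').F (N i') := ⟨i, hi, rfl⟩
      simp only [p, dif_pos hex]
      rw [← hN i _ (d i) rfl hex.choose_spec.2]
    have hp2 : ∀ i ∉ T, ∀ j : ASet, j.F (N i) = (d i).F (N i) → p j = empty := by
      intro i hi j hj
      refine dif_neg ?_
      rintro ⟨i', hi', e⟩
      exact hi (hN i i' j hj e ▸ hi')
    have hp : ∀ j j' : ASet, j.F (T.sup N) = j'.F (T.sup N) → p j = p j' := by
      intro j j' e
      have : (fun i => i ∈ T ∧ j.F (N i) = (d i).F (N i)) =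
          fun i => i ∈ T ∧ j'.F (N i) = (d i).F (N i) := by
        ext i
        refine and_congr_right fun hi => ?_
        rw [F_eq_of_le (Finset.le_sup hi) e]
      simp only [p, this]
    have hc := h.continuousOn_select hne hp
    refine ⟨_, h.isChoiceFunction_graph hc fun j hj => select_mem _ (hne j hj), ?_, ?_⟩
    · intro i hi
      rw [opair_mem_graph hc, hp1 i hi]
      exact ⟨hdJ i, (select_of_mem (ha i)).symm⟩
    · intro i hi hl
      -- A pair of the graph this close to `(d i, a i)` has its index near `d i`, hence a default
      -- value, which `a i` avoids at level `m i`.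
      obtain ⟨y, hy, e⟩ := exists_mem_of_level hl
      obtain ⟨j, hj, rfl⟩ := (mem_graph hc).1 hy
      obtain ⟨e1, e2⟩ := opair_F_inj.1 e
      rw [hp2 i hi j e1] at e2
      refine hm i ((F_eq_of_le (hmN i) e2).symm.trans ?_)
      exact select_F_congr _ (hne j hj) (hne _ (hdJ i))
        (hk i j hj (d i) (hdJ i) (F_eq_of_le (hkN i) e1))
  -- Both conditions are closed in `r`, and `key` satisfies any finitely many of them, so
  -- compactness handles infinite `S`.
  have hlim : ∀ S : Set ℕ, ∃ r ∈ product I J, ∀ i, (i ∈ S → opair (d i) (a i) ∈ r) ∧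
      (i ∉ S → (opair (d i) (a i)).F (N i + 2) ∉ level r (N i + 2)) := by
    intro S
    classical
    let t : ℕ → Set ASet := fun i => if i ∈ S then {r | opair (d i) (a i) ∈ r} else
      {r | (opair (d i) (a i)).F (N i + 2) ∉ level r (N i + 2)}
    have ht : ∀ i, IsClosed (t i) := by
      intro i
      simp only [t]
      split_ifs
      · exact isClosed_mem.preimage (continuous_const.prodMk continuous_id)
      · exact (isClopen_F (N i + 2 + 1) {L : Set (Approx (N i + 2)) |
          (opair (d i) (a i)).F (N i + 2) ∉ L}).1
    obtain ⟨r, hr, hrt⟩ := (isCompact_carrier (product I J)).inter_iInter_nonempty t ht (by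
      intro u
      obtain ⟨f, hf, h1, h2⟩ := key {i ∈ u | i ∈ S}
      refine ⟨f, subset_hull hf, mem_iInter₂.2 fun i hi => ?_⟩
      simp only [t]
      split_ifs with hS
      · exact h1 i (by simp [hi, hS])
      · exact h2 i (by simp [hS]))
    refine ⟨r, hr, fun i => ⟨fun hi => ?_, fun hi => ?_⟩⟩
    · have := mem_iInter.1 hrt i
      simp only [t, if_pos hi] at this
      exact this
    · have := mem_iInter.1 hrt i
      simp only [t, if_neg hi] at this
      exact this
  choose r hr hri using hlim
  refine not_countable_of_injective hr fun S S' e => ?_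
  have hiff : ∀ S i, opair (d i) (a i) ∈ r S ↔ i ∈ S := fun S i =>
    ⟨fun hm => by_contra fun hi => (hri S i).2 hi (hm _), (hri S i).1⟩
  ext i
  rw [← hiff S, ← hiff S', e]

/-- Limits of choice functions remain total with values in the factors, and stay single-valued at
isolated indices; a trivial factor leaves no choice of value. -/
theorem IsSystem.countable_product (h : IsSystem I J G)
    (hD : {j | j ∈ J ∧ (carrier (G j)).Nontrivial}.Finite)
    (hc : ∀ j ∈ J, (carrier (G j)).Countable) : (carrier (product I J)).Countable := by
  set D := {j | j ∈ J ∧ (carrier (G j)).Nontrivial}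
  have hsub : ∀ r ∈ product I J, ∀ x ∈ r, ∃ j ∈ J, ∃ b ∈ G j, x = opair j b := by
    have hcl : IsClosed {x | ∃ j ∈ J, ∃ b ∈ G j, x = opair j b} := by
      have : IsClosed {q : ASet × ASet × ASet | opair q.1 q.2.1 ∈ I ∧ q.2.2 ∈ q.2.1} := by
        refine IsClosed.inter ((isClosed_carrier I).preimage (continuous_opair.comp
          (continuous_fst.prodMk (continuous_fst.comp continuous_snd)))) ?_
        exact isClosed_mem.preimage ((continuous_snd.comp continuous_snd).prodMk
          (continuous_fst.comp continuous_snd))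
      have hcont : Continuous fun q : ASet × ASet × ASet => opair q.1 q.2.2 :=
        continuous_opair.comp (continuous_fst.prodMk (continuous_snd.comp continuous_snd))
      convert (this.isCompact.image hcont).isClosed using 1
      ext x
      constructor
      · rintro ⟨j, hj, b, hb, rfl⟩
        exact ⟨(j, G j, b), ⟨(h.opair_mem _ _).2 ⟨hj, rfl⟩, hb⟩, rfl⟩
      · rintro ⟨⟨j, X, b⟩, ⟨hX, hb⟩, rfl⟩
        obtain ⟨hj, rfl⟩ := (h.opair_mem j X).1 hX
        exact ⟨j, hj, b, hb, rfl⟩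
    intro r hr x hx
    have hP : product I J ⊆ powerset (hull fun x => ∃ j ∈ J, ∃ b ∈ G j, x = opair j b) := by
      refine hull_subset fun f hf => mem_powerset.2 fun x hx => subset_hull ?_
      obtain ⟨⟨B, hB⟩, hf'⟩ := hf
      obtain ⟨j, b, hj, -, rfl⟩ := hB.isRelation x hx
      exact ⟨j, hj, b, hf' j b _ hx ((h.opair_mem _ _).2 ⟨hj, rfl⟩), rfl⟩
    exact (mem_hull_of_isClosed hcl).1 (mem_powerset.1 (hP r hr) x hx)
  have htot : ∀ r ∈ product I J, ∀ j ∈ J, ∃ b, opair j b ∈ r := by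
    intro r hr j hj
    -- Having a value at `j` is a projection of a compact set.
    have hcl : IsClosed {r : ASet | ∃ b, opair j b ∈ r} := by
      have : IsClosed {q : ASet × ASet | opair j q.2 ∈ q.1} := isClosed_mem.preimage
        ((continuous_opair.comp (continuous_const.prodMk continuous_snd)).prodMk continuous_fst)
      convert (this.isCompact.image continuous_fst).isClosed using 1
      ext r
      simp
    refine mem_of_mem_hull hcl (fun f hf => ?_) hr
    obtain ⟨⟨B, hB⟩, -⟩ := hf
    obtain ⟨b, -, hb⟩ := hB.total j hj
    exact ⟨b, hb⟩
  -- the indices of nontrivial factors are isolated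
  have hiso : ∀ j ∈ D, ∃ n, ∀ j' ∈ J, j'.F n = j.F n → j' = j := by
    rintro j hjD
    obtain ⟨hj, x, hx, y, hy, hxy⟩ := hjD
    obtain ⟨m, hm⟩ := ne_iff_exists.1 hxy
    obtain ⟨k, hk⟩ := h.exists_F (m + 1)
    -- Two distinct elements of `G j` persist in `G j'` for `j'` near `j`; as `D` is finite, this
    -- isolates `j`.
    have hopen : ∀ j' ∈ J, j'.F k = j.F k → j' ∈ D := by
      intro j' hj' e
      have e := (hk j' hj' j hj e).symm
      obtain ⟨x', hx', ex⟩ := exists_mem_of_F_eq e hx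
      obtain ⟨y', hy', ey⟩ := exists_mem_of_F_eq e hy
      refine ⟨hj', x', hx', y', hy', ?_⟩
      rintro rfl
      exact hm (ex.symm.trans ey)
    have hfin : ∀ᶠ n in Filter.atTop, ∀ j' ∈ D, j' ≠ j → j'.F n ≠ j.F n := by
      rw [Filter.eventually_all_finite hD]
      intro j' _
      by_cases hjj : j' = j
      · exact Filter.Eventually.of_forall fun n hn => absurd hjj hn
      · obtain ⟨n, hn⟩ := ne_iff_exists.1 hjj
        exact Filter.eventually_atTop.2 ⟨n, fun m hm _ => F_ne_of_le hm hn⟩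
    obtain ⟨n, hn, hkn⟩ := (hfin.and (Filter.eventually_ge_atTop k)).exists
    refine ⟨n, fun j' hj' e => ?_⟩
    by_contra hne
    exact hn j' (hopen j' hj' (F_eq_of_le hkn e)) hne e
  have huniq : ∀ r ∈ product I J, ∀ j ∈ D, ∀ b b', opair j b ∈ r → opair j b' ∈ r → b = b' := by
    intro r hr j hj b b' hb hb'
    obtain ⟨n, hn⟩ := hiso j hj
    by_contra hne
    obtain ⟨m, hm⟩ := ne_iff_exists.1 hne
    -- Level `n` forces the index to be `j`, level `m` separates the values; ordered pairs cost 2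
    -- levels and membership 1.
    obtain ⟨f, ⟨⟨B, hB⟩, -⟩, hf⟩ := hr (max n m + 2 + 1)
    have key : ∀ c, opair j c ∈ r → ∃ c', opair j c' ∈ f ∧ c'.F m = c.F m := by
      intro c hc
      obtain ⟨x, hx, e⟩ := exists_mem_of_F_eq hf.symm hc
      obtain ⟨j', c', hj', -, rfl⟩ := hB.isRelation x hx
      obtain ⟨e1, e2⟩ := opair_F_inj.1 e
      obtain rfl := hn j' hj' (F_eq_of_le (le_max_left _ _) e1)
      exact ⟨c', hx, F_eq_of_le (le_max_right _ _) e2⟩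
    obtain ⟨c, hc, e⟩ := key b hb
    obtain ⟨c', hc', e'⟩ := key b' hb'
    rw [hB.functional j c c' hc hc'] at e
    exact hm (e.symm.trans e')
  choose! v hv using htot
  have hvG : ∀ r ∈ product I J, ∀ j ∈ J, v r j ∈ G j := by
    intro r hr j hj
    obtain ⟨j', -, b, hb, e⟩ := hsub r hr _ (hv r hr j hj)
    obtain ⟨rfl, rfl⟩ := opair_inj.1 e
    exact hb
  have key : ∀ r ∈ product I J, ∀ r' ∈ product I J, (∀ j ∈ D, v r j = v r' j) → r ⊆ r' := by
    intro r hr r' hr' e x hx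
    obtain ⟨j, hj, b, hb, rfl⟩ := hsub r hr x hx
    suffices b = v r' j from this ▸ hv r' hr' j hj
    by_cases hjD : j ∈ D
    · rw [← e j hjD]
      exact huniq r hr j hjD b _ hx (hv r hr j hj)
    · by_contra hne
      exact hjD ⟨hj, b, hb, v r' j, hvG r' hr' j hj, hne⟩
  have := hD.to_subtype
  have hcount : {φ : D → ASet | ∀ j : D, φ j ∈ carrier (G j)}.Countable :=
    countable_pi fun j => hc j j.2.1
  refine MapsTo.countable_of_injOn (f := fun r (j : D) => v r j) ?_ ?_ hcount
  · exact fun r hr j => hvG r hr j j.2.1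
  · intro r hr r' hr' e
    have e' : ∀ j ∈ D, v r j = v r' j := fun j hj => congrFun e ⟨j, hj⟩
    exact ext_mem fun x => ⟨key r hr r' hr' e' x, key r' hr' r hr (fun j hj => (e' j hj).symm) x⟩

/-! ### Finite ordinals and cardinalities -/

theorem mem_ordinal_one {x : ASet} : x ∈ ordinal 1 ↔ x = empty := by
  change x ∈ adjoin empty empty ↔ _
  rw [mem_adjoin]
  exact or_iff_right (not_mem_empty x)

theorem ordinal_zero_mem_two : ordinal 0 ∈ ordinal 2 :=
  mem_adjoin.2 (Or.inl (mem_ordinal_one.2 rfl))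

theorem ordinal_one_mem_two : ordinal 1 ∈ ordinal 2 := mem_adjoin.2 (Or.inr rfl)

theorem subset_ordinal {n : ℕ} {x : ASet} (h : x ∈ ordinal n) : x ⊆ ordinal n := by
  induction n with
  | zero => exact (not_mem_empty x h).elim
  | succ n ih =>
    intro y hy
    rcases mem_adjoin.1 h with h | rfl
    · exact mem_adjoin.2 (Or.inl (ih h y hy))
    · exact mem_adjoin.2 (Or.inl hy)

theorem ordinal_not_mem_self (n : ℕ) : ordinal n ∉ ordinal n := by
  induction n with
  | zero => exact not_mem_empty _
  | succ n ih =>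
    intro h
    have hn : ordinal n ∈ ordinal (n + 1) := mem_adjoin.2 (Or.inr rfl)
    rcases mem_adjoin.1 h with h | h
    · exact ih (subset_ordinal h _ hn)
    · exact ih (h ▸ hn)

theorem ordinal_mem_of_lt {m n : ℕ} (h : m < n) : ordinal m ∈ ordinal n := by
  induction n, h using Nat.le_induction with
  | base => exact mem_adjoin.2 (Or.inr rfl)
  | succ k _ ih => exact mem_adjoin.2 (Or.inl ih)

theorem ordinal_injective : Function.Injective ordinal := by
  intro m n h
  by_contra hne
  rcases lt_or_gt_of_ne hne with hlt | hlt
  · have := ordinal_mem_of_lt hlt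
    rw [h] at this
    exact ordinal_not_mem_self n this
  · have := ordinal_mem_of_lt hlt
    rw [h] at this
    exact ordinal_not_mem_self n this

theorem infinite_omega : (carrier omega).Infinite :=
  infinite_of_injective_forall_mem ordinal_injective fun n => subset_hull ⟨n, rfl⟩

theorem IsInfinite.infinite {B : ASet} (h : IsInfinite B) : (carrier B).Infinite := by
  obtain ⟨C, f, hC, hne, hf⟩ := h
  intro hfin
  obtain ⟨g, hg, hg', -⟩ := hf.toIsFunction.exists_map
  have hinj : InjOn g (carrier B) := fun x hx y hy e =>
    hf.injective x y (g x) ((hg' _ _).2 ⟨hx, rfl⟩) ((hg' _ _).2 ⟨hy, e⟩)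
  have hmaps : MapsTo g (carrier B) (carrier B) := fun x hx => hC _ (hg x hx)
  have hsurj := (hfin.injOn_iff_bijOn_of_mapsTo hmaps).1 hinj |>.surjOn
  refine hne (ext_mem fun x => ⟨hC x, fun hx => ?_⟩)
  obtain ⟨y, hy, rfl⟩ := hsurj hx
  exact hg y hy

theorem nontrivial_of_leCard {A B : ASet} (hA : (carrier A).Nontrivial) (h : LeCard A B) :
    (carrier B).Nontrivial := by
  obtain ⟨f, hf⟩ := h
  obtain ⟨x, hx, y, hy, hxy⟩ := hA
  obtain ⟨u, hu, hu'⟩ := hf.total x hx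
  obtain ⟨w, hw, hw'⟩ := hf.total y hy
  refine ⟨u, hu, w, hw, ?_⟩
  rintro rfl
  exact hxy (hf.injective x y u hu' hw')

theorem nontrivial_ordinal_two : (carrier (ordinal 2)).Nontrivial :=
  ⟨_, ordinal_zero_mem_two, _, ordinal_one_mem_two, ordinal_injective.ne (by decide)⟩

theorem ltCard_one_iff {X : ASet} (hX : X ≠ empty) :
    LtCard (ordinal 1) X ↔ (carrier X).Nontrivial := by
  obtain ⟨x, hx⟩ := ne_empty_iff.1 hX
  have h1 : LeCard (ordinal 1) X := by
    refine leCard_of_injOn (g := fun _ => x) continuousOn_const (fun _ _ => hx) ?_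
    intro a ha b hb _
    rw [mem_ordinal_one.1 ha, mem_ordinal_one.1 hb]
  constructor
  · rintro ⟨-, hn⟩
    by_contra hX'
    rw [not_nontrivial_iff] at hX'
    exact hn ⟨h1, leCard_of_injOn (g := fun _ => empty) continuousOn_const
      (fun _ _ => mem_ordinal_one.2 rfl) fun a ha b hb _ => hX' ha hb⟩
  · intro hX'
    refine ⟨h1, fun ⟨_, h⟩ => ?_⟩
    obtain ⟨a, ha, b, hb, hab⟩ := nontrivial_of_leCard hX' h
    exact hab ((mem_ordinal_one.1 ha).trans (mem_ordinal_one.1 hb).symm)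

/-! ### Powers -/

theorem isSystem_const (A B : ASet) : IsSystem (graph B fun _ => A) B fun _ => A where
  opair_mem _ _ := opair_mem_graph continuousOn_const
  exists_F _ := ⟨0, fun _ _ _ _ _ => rfl⟩

/-- The choice functions on a constant system are the functions into `A`, so the uncountability
result for products applies to powers. -/
theorem power_eq_product (A B : ASet) : power A B = product (graph B fun _ => A) B := by
  have hI := isSystem_const A B
  unfold power product
  congr 1
  ext f
  constructor
  · intro h
    refine ⟨⟨A, h⟩, fun j a X ha hX => ?_⟩
    rw [((hI.opair_mem _ _).1 hX).2]
    exact (h.mem ha).2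
  · rintro ⟨⟨C, h⟩, hf⟩
    have hA : ∀ j a, opair j a ∈ f → a ∈ A := fun j a ha =>
      hf j a A ha ((hI.opair_mem _ _).2 ⟨(h.mem ha).1, rfl⟩)
    refine ⟨fun x hx => ?_, fun j hj => ?_, h.functional⟩
    · obtain ⟨j, a, hj, -, rfl⟩ := h.isRelation x hx
      exact ⟨j, a, hj, hA j a hx, rfl⟩
    · obtain ⟨a, -, ha⟩ := h.total j hj
      exact ⟨a, hA j a ha, ha⟩

theorem not_countable_power {A B : ASet} (hB : (carrier B).Infinite)
    (hA : (carrier A).Nontrivial) : ¬ (carrier (power A B)).Countable := by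
  rw [power_eq_product]
  refine (isSystem_const A B).not_countable_product
    (fun _ _ => ne_empty_iff.2 hA.nonempty) (hB.mono fun j hj => ⟨hj, hA⟩)

end AS

theorem theorem10p9 :
    -- `I = {(j, A_j) | j ∈ J}` is an indexed system of sets with all `A_j` nonempty
    (∀ I J 𝓕 : ASet, AS.IsFunction I J 𝓕 → (∀ j X : ASet, AS.opair j X ∈ I → X ≠ AS.empty) →
      (AS.WellOrderable (AS.product I J) ↔
        {j : ASet | ∃ X : ASet, AS.opair j X ∈ I ∧ AS.LtCard (AS.ordinal 1) X}.Finite ∧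
          ∀ j X : ASet, AS.opair j X ∈ I → AS.WellOrderable X)) ∧
    -- if some `A_j` is empty, then so is the product
    (∀ I J 𝓕 : ASet, AS.IsFunction I J 𝓕 → (∃ j : ASet, AS.opair j AS.empty ∈ I) →
      AS.product I J = AS.empty ∧ AS.WellOrderable (AS.product I J)) ∧
    (∀ A B : ASet, AS.IsInfinite B → AS.LeCard (AS.ordinal 2) A →
      AS.EqCard (AS.power A B) (AS.powerset AS.omega)) := by
  refine ⟨fun I J 𝓕 hI hne => ?_, fun I J 𝓕 hI ⟨j, hj⟩ => ?_, fun A B hB hA => ⟨?_, ?_⟩⟩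
  · obtain ⟨G, hG⟩ := hI.exists_isSystem
    have hne' : ∀ j ∈ J, G j ≠ AS.empty := fun j hj => hne j _ ((hG.opair_mem _ _).2 ⟨hj, rfl⟩)
    have hD : {j : ASet | ∃ X : ASet, AS.opair j X ∈ I ∧ AS.LtCard (AS.ordinal 1) X} =
        {j | j ∈ J ∧ (AS.carrier (G j)).Nontrivial} := by
      ext j
      constructor
      · rintro ⟨X, hX, hlt⟩
        have hX' := (hG.opair_mem _ _).1 hX
        exact ⟨hX'.1, hX'.2 ▸ (AS.ltCard_one_iff (hne j X hX)).1 hlt⟩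
      · rintro ⟨hj, hn⟩
        exact ⟨G j, (hG.opair_mem _ _).2 ⟨hj, rfl⟩, (AS.ltCard_one_iff (hne' j hj)).2 hn⟩
    rw [hD, AS.wellOrderable_iff_countable]
    constructor
    · intro hc
      refine ⟨?_, fun j X hX => ?_⟩
      · by_contra hinf
        exact hG.not_countable_product hne' hinf hc
      · obtain ⟨hj, rfl⟩ := (hG.opair_mem _ _).1 hX
        exact AS.wellOrderable_iff_countable.2 (hG.countable_of_countable_product hne' hc hj)
    · rintro ⟨hfin, hc⟩
      exact hG.countable_product hfin fun j hj =>
        (hc j _ ((hG.opair_mem _ _).2 ⟨hj, rfl⟩)).countable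
  · have he : AS.product I J = AS.empty := by
      refine AS.eq_empty_iff.2 fun x hx => ?_
      -- An element of a hull yields a generator at any level, here an impossible choice function.
      obtain ⟨f, ⟨⟨B, hB⟩, hf⟩, -⟩ := hx 0
      obtain ⟨a, -, ha⟩ := hB.total j (hI.mem hj).1
      exact AS.not_mem_empty a (hf j a _ ha hj)
    refine ⟨he, AS.wellOrderable_iff_countable.2 ?_⟩
    rw [he]
    exact Set.countable_empty.mono fun x hx => AS.not_mem_empty x hx
  · exact AS.leCard_of_not_countable _ (AS.not_countable_powerset AS.infinite_omega)
  · exact AS.leCard_of_not_countable _ (AS.not_countable_power hB.infinite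
      (AS.nontrivial_of_leCard AS.nontrivial_ordinal_two hA))
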